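/- Let $M,K$ be numbers of single-antenna base stations and users. Let $h_k\in\mathbb C^M$, noise levels $\sigma_k>0$ and SINR targets $\bar\gamma_k>0$ ($1\le k\le K$), and fronthaul capacities $\bar C_m\in\mathbb R$ and power budgets $\bar P_m\in\mathbb R$ ($1\le m\le M$) be given. For Hermitian $M\times M$ matrices $V_1,\dots,V_K,Q$ write $p_m(V,Q)=\sum_{k}V_k^{(m,m)}+Q^{(m,m)}$, let $E_m$ be the $M\times M$ matrix whose only nonzero entry is a $1$ at $(m,m)$, and let $Q^{(m:M,m:M)}$ be the principal submatrix of $Q$ with indices $m,\dots,M$. For $\mu\in\mathbb R^M$ consider the problem $$\min_{V_1,\dots,V_K\succeq 0,\;Q\succeq 0}\ \sum_{m=1}^M(1+\mu_m)\,p_m(V,Q)$$ subject to $$\frac{\bar\gamma_k+1}{\bar\gamma_k}\operatorname{tr}(V_kh_kh_k^{\mathsf H})-\sum_{j=1}^K\operatorname{tr}(V_jh_kh_k^{\mathsf H})-\operatorname{tr}(Qh_kh_k^{\mathsf H})-\sigma_k^2\ \ge\ 0\qquad(1\le k\le K),$$ $$2^{\bar C_m}\begin{bmatrix}0&0\\0&Q^{(m:M,m:M)}\end{bmatrix}-p_m(V,Q)\,E_m\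 \succeq\ 0\qquad(1\le m\le M),$$ and let $d(\mu)$ be its optimal value, and $f(\mu)=d(\mu)-\sum_{m=1}^M\mu_m\bar P_m$. Suppose that the problem is strictly feasible, that is, some $V_1,\dots,V_K\succ0$, $Q\succ 0$ satisfy the first family of constraints with $>0$ and make the block with indices $m,\dots,M$ of the $m$-th matrix of the second family positive definite for every $m$ (this does not depend on $\mu$). Then for every $\mu\ge 0$ the problem has exactly one optimal solution $(\{V_k^\star(\mu)\},Q^\star(\mu))$, the function $f$ is differentiable at $\mu$, and the $m$-th component of its gradient is $$\frac{\partial f}{\partial\mu_m}(\mu)=\sum_{k=1}^KV_k^{\star(m,m)}(\mu)+Q^{\star(m,m)}(\mu)-\bar P_m\qquad(1\le m\le M).$$ -/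

import Mathlib

open scoped Matrix ComplexOrder

noncomputable section

/-- Data of a cooperative downlink network with `M` single-antenna base stations and `K`
single-antenna users. -/
structure Network (M K : ℕ) where
  /-- channel vectors `h_k ∈ ℂ^M` -/
  h : Fin K → Fin M → ℂ
  /-- noise standard deviations `σ_k` (the noise powers are `σ_k ^ 2`) -/
  σ : Fin K → ℝ
  /-- SINR targets -/
  γ : Fin K → ℝ
  /-- fronthaul capacities -/
  C : Fin M → ℝ
  /-- per-antenna power budgets -/
  P : Fin M → ℝ

namespace Network

variable {M K : ℕ}

/-- Transmit power of antenna `m`: `∑_k V_k^(m,m) + Q^(m,m)`. The diagonal entries of Hermitian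
matrices are real, so that taking the real part loses nothing for the points of interest. -/
def antennaPower (V : Fin K → Matrix (Fin M) (Fin M) ℂ) (Q : Matrix (Fin M) (Fin M) ℂ)
    (m : Fin M) : ℝ :=
  (∑ k, V k m m + Q m m).re

/-- The number `tr(A h_k h_kᴴ)`, which is real for Hermitian `A`. -/
def gain (N : Network M K) (A : Matrix (Fin M) (Fin M) ℂ) (k : Fin K) : ℝ :=
  (A * Matrix.vecMulVec (N.h k) (star (N.h k))).trace.re

/-- Left-hand side of the SINR constraint of user `k`:
`((γ_k + 1) / γ_k) tr(V_k h_k h_kᴴ) - ∑_j tr(V_j h_k h_kᴴ) - tr(Q h_k h_kᴴ) - σ_k ^ 2`. -/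
def sinrSlack (N : Network M K) (V : Fin K → Matrix (Fin M) (Fin M) ℂ)
    (Q : Matrix (Fin M) (Fin M) ℂ) (k : Fin K) : ℝ :=
  (N.γ k + 1) / N.γ k * N.gain (V k) k - ∑ j, N.gain (V j) k - N.gain Q k - N.σ k ^ 2

/-- The `M × M` matrix that keeps the block `Q^(m:M, m:M)` of `Q` in its place and is zero
elsewhere. -/
def trailingBlock (Q : Matrix (Fin M) (Fin M) ℂ) (m : Fin M) : Matrix (Fin M) (Fin M) ℂ :=
  Matrix.of fun i j => if m ≤ i ∧ m ≤ j then Q i j else 0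

/-- Left-hand side of the fronthaul rate constraint of base station `m`:
`2 ^ C_m [0, 0; 0, Q^(m:M, m:M)] - (∑_k V_k^(m,m) + Q^(m,m)) E_m`. -/
def fronthaulMatrix (N : Network M K) (V : Fin K → Matrix (Fin M) (Fin M) ℂ)
    (Q : Matrix (Fin M) (Fin M) ℂ) (m : Fin M) : Matrix (Fin M) (Fin M) ℂ :=
  (((2 : ℝ) ^ N.C m : ℝ) : ℂ) • trailingBlock Q m
    - Matrix.single m m ((antennaPower V Q m : ℝ) : ℂ)

/-- Feasible points of the weighted power minimization problem (the constraints do not depend on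
the weights). -/
structure Feasible (N : Network M K) (V : Fin K → Matrix (Fin M) (Fin M) ℂ)
    (Q : Matrix (Fin M) (Fin M) ℂ) : Prop where
  posSemidef_V : ∀ k, (V k).PosSemidef
  posSemidef_Q : Q.PosSemidef
  sinr : ∀ k, 0 ≤ N.sinrSlack V Q k
  fronthaul : ∀ m, (N.fronthaulMatrix V Q m).PosSemidef

/-- Strictly feasible points: every inequality is strict. The rows and columns of the `m`-th
fronthaul matrix with index below `m` vanish identically, so that its strict version says that the
remaining block, with the indices `m, …, M`, is positive definite. -/
structure StrictlyFeasible (N : Network M K) (V : Fin K → Matrix (Fin M) (Fin M) ℂ)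
    (Q : Matrix (Fin M) (Fin M) ℂ) : Prop where
  posDef_V : ∀ k, (V k).PosDef
  posDef_Q : Q.PosDef
  sinr : ∀ k, 0 < N.sinrSlack V Q k
  fronthaul : ∀ m, ((N.fronthaulMatrix V Q m).submatrix
    (Subtype.val : {i : Fin M // m ≤ i} → Fin M) Subtype.val).PosDef

/-- The weighted transmit power `∑_m (1 + μ_m) (∑_k V_k^(m,m) + Q^(m,m))`. -/
def weightedPower (μ : EuclideanSpace ℝ (Fin M)) (V : Fin K → Matrix (Fin M) (Fin M) ℂ)
    (Q : Matrix (Fin M) (Fin M) ℂ) : ℝ :=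
  ∑ m, (1 + μ m) * antennaPower V Q m

/-- `(V, Q)` is an optimal solution of the weighted power minimization problem for `μ`. -/
def IsSolution (N : Network M K) (μ : EuclideanSpace ℝ (Fin M))
    (V : Fin K → Matrix (Fin M) (Fin M) ℂ) (Q : Matrix (Fin M) (Fin M) ℂ) : Prop :=
  N.Feasible V Q ∧ ∀ V' Q', N.Feasible V' Q' → weightedPower μ V Q ≤ weightedPower μ V' Q'

/-- The optimal value `d(μ)` of the weighted power minimization problem. -/
def optimalValue (N : Network M K) (μ : EuclideanSpace ℝ (Fin M)) : ℝ :=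
  sInf {p : ℝ | ∃ V Q, N.Feasible V Q ∧ p = weightedPower μ V Q}

/-- The partial Lagrangian dual function `f(μ) = d(μ) - ∑_m μ_m P_m`. -/
def dualFunction (N : Network M K) (μ : EuclideanSpace ℝ (Fin M)) : ℝ :=
  N.optimalValue μ - ∑ m, μ m * N.P m

end Network

end

/-! Uniqueness rests on monotonicity in the Loewner order. All weights `1 + μ m` are positive, so a
feasible point below a solution has the same antenna powers; the differences are then positive
semidefinite with zero diagonal, hence zero (`IsSolution.eq_of_posSemidef_sub`). Two ways of
lowering a solution keep it feasible. Replacing `V k` by `V k h hᴴ V k / (hᴴ V k h)` shows that `V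
k` has rank one. Writing `Q = Tᴴ D T` with `T` unit lower triangular and shrinking each `d m` to `2
^ (-C m)` times the power of antenna `m` shows that the fronthaul constraints are tight.

By convexity the midpoint of two solutions is a solution. Its rank-one structure and its tightness
pass to both endpoints, which therefore share the directions `v k` and the factor `T` and can differ
only in the scalings `t k` and `d m` (`IsSolution.exists_common_factorization`). Each constraint
profits from only one scaling, `t k` for SINR `k` and `d m` for fronthaul `m`, and every other one
can only hurt. So the entrywise minimum of the scalings is feasible; it lies below both solutions
and equals both (`IsSolution.unique`).

The optimal value is an infimum of linear functionals of the weights over the set of feasible power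
vectors. That set consists of nonnegative vectors and has compact truncations, so positive weights
attain the infimum, and Danskin's theorem (`hasGradientAt_sInf_inner`) makes the unique minimizing
power vector the gradient. Strict feasibility supplies the feasible point from which existence
starts. -/

/-! ### Hermitian forms and rank-one matrices -/

namespace Matrix

variable {n : Type*}

lemma PosSemidef.re_diag_nonneg {A : Matrix n n ℂ} (hA : A.PosSemidef) (i : n) :
    0 ≤ (A i i).re :=
  (Complex.nonneg_iff.1 hA.diag_nonneg).1

variable [Fintype n]

/-- The real number `xᴴ A x`, for Hermitian `A`. -/
def hermForm (A : Matrix n n ℂ) (x : n → ℂ) : ℝ := (star x ⬝ᵥ A *ᵥ x).re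

lemma hermForm_add (A B : Matrix n n ℂ) (x : n → ℂ) :
    hermForm (A + B) x = hermForm A x + hermForm B x := by
  simp [hermForm, add_mulVec, dotProduct_add]

lemma hermForm_sub (A B : Matrix n n ℂ) (x : n → ℂ) :
    hermForm (A - B) x = hermForm A x - hermForm B x := by
  simp [hermForm, sub_mulVec, dotProduct_sub]

lemma hermForm_smul (c : ℝ) (A : Matrix n n ℂ) (x : n → ℂ) :
    hermForm ((c : ℂ) • A) x = c * hermForm A x := by
  simp [hermForm, smul_mulVec, dotProduct_smul]

lemma hermForm_conjTranspose_mul_mul (A B : Matrix n n ℂ) (x : n → ℂ) :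
    hermForm (Bᴴ * A * B) x = hermForm A (B *ᵥ x) := by
  simp only [hermForm, ← mulVec_mulVec, star_mulVec, dotProduct_mulVec, vecMul_vecMul]

lemma hermForm_diagonal [DecidableEq n] (d : n → ℝ) (x : n → ℂ) :
    hermForm (diagonal fun i => (d i : ℂ)) x = ∑ i, d i * ‖x i‖ ^ 2 := by
  simp only [hermForm, dotProduct, mulVec_diagonal, Complex.re_sum]
  refine Finset.sum_congr rfl fun i _ => ?_
  rw [mul_left_comm, Pi.star_apply, Complex.star_def, Complex.conj_mul', Complex.re_ofReal_mul]
  norm_cast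

lemma PosSemidef.hermForm_nonneg {A : Matrix n n ℂ} (hA : A.PosSemidef) (x : n → ℂ) :
    0 ≤ hermForm A x :=
  hA.re_dotProduct_nonneg x

lemma IsHermitian.coe_hermForm {A : Matrix n n ℂ} (hA : A.IsHermitian) (x : n → ℂ) :
    (hermForm A x : ℂ) = star x ⬝ᵥ A *ᵥ x := by
  have h : star (star x ⬝ᵥ A *ᵥ x) = star x ⬝ᵥ A *ᵥ x := by
    rw [← star_dotProduct_star, star_star, star_mulVec, hA.eq, ← dotProduct_mulVec]
  exact Complex.conj_eq_iff_re.1 h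

lemma IsHermitian.posSemidef_of_hermForm_nonneg {A : Matrix n n ℂ} (hA : A.IsHermitian)
    (h : ∀ x, 0 ≤ hermForm A x) : A.PosSemidef :=
  .of_dotProduct_mulVec_nonneg hA fun x => by
    rw [← hA.coe_hermForm]; exact_mod_cast h x

lemma PosSemidef.mulVec_eq_zero_of_hermForm {A : Matrix n n ℂ} (hA : A.PosSemidef) {x : n → ℂ}
    (h : hermForm A x ≤ 0) : A *ᵥ x = 0 := by
  rw [← hA.dotProduct_mulVec_zero_iff, ← hA.1.coe_hermForm,
    le_antisymm h (hA.hermForm_nonneg x), Complex.ofReal_zero]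

lemma PosSemidef.eq_zero_of_re_diag {A : Matrix n n ℂ} (hA : A.PosSemidef)
    (h : ∀ i, (A i i).re = 0) : A = 0 := by
  rw [← hA.trace_eq_zero_iff]
  refine Finset.sum_eq_zero fun i _ => ?_
  exact Complex.ext (h i) (Complex.nonneg_iff.1 (hA.diag_nonneg (i := i))).2.symm

lemma hermForm_vecMulVec (v x : n → ℂ) :
    hermForm (vecMulVec v (star v)) x = ‖star v ⬝ᵥ x‖ ^ 2 := by
  have h : vecMulVec v (star v) *ᵥ x = (star v ⬝ᵥ x) • v := by
    ext i; simp [vecMulVec_mulVec, mul_comm]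
  rw [hermForm, h, dotProduct_smul, smul_eq_mul,
    show star x ⬝ᵥ v = star (star v ⬝ᵥ x) by rw [← star_dotProduct_star, star_star],
    Complex.star_def, Complex.mul_conj']
  norm_cast

/-- A positive semidefinite matrix below `v vᴴ` in the Loewner order is a multiple of it. -/
lemma PosSemidef.eq_smul_vecMulVec {A : Matrix n n ℂ} (hA : A.PosSemidef) {v : n → ℂ}
    (h : (vecMulVec v (star v) - A).PosSemidef) :
    ∃ t : ℝ, 0 ≤ t ∧ A = (t : ℂ) • vecMulVec v (star v) := by
  classical
  -- Orthogonally to `v` the form of `A` is squeezed between zero and the vanishing form of `v vᴴ`.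
  have hker : ∀ x, star v ⬝ᵥ x = 0 → A *ᵥ x = 0 := fun x hx => by
    refine hA.mulVec_eq_zero_of_hermForm ?_
    have := h.hermForm_nonneg x
    rw [hermForm_sub, hermForm_vecMulVec, hx] at this
    simpa using this
  by_cases hv : v = 0
  · refine ⟨0, le_rfl, ?_⟩
    subst hv
    rw [Complex.ofReal_zero, zero_smul]
    exact ext_of_mulVec_single fun i => by rw [hker _ (by simp), zero_mulVec]
  set g : ℂ := star v ⬝ᵥ v with hg
  have hg0 : g ≠ 0 := by simpa [hg, dotProduct_star_self_eq_zero] using hv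
  -- A basis vector is a multiple of `v` plus a vector orthogonal to `v`, which `A` kills.
  have hAP : A = g⁻¹ • vecMulVec (A *ᵥ v) (star v) := by
    refine ext_of_mulVec_single fun i => ?_
    have := hker (Pi.single i 1 - (g⁻¹ * (star v ⬝ᵥ Pi.single i 1)) • v) (by
      rw [dotProduct_sub, dotProduct_smul, ← hg, smul_eq_mul]; field_simp; simp)
    rw [mulVec_sub, sub_eq_zero, mulVec_smul] at this
    rw [this, smul_mulVec, vecMulVec_mulVec]
    ext j; simp [mul_assoc, mul_comm]
  -- Hermitian symmetry transfers the rank-one form from rows to columns, so `A v` is a multiple of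
  -- `v`.
  have hvA : A *ᵥ v = (g⁻¹ * (star v ⬝ᵥ A *ᵥ v)) • v := by
    have h1 : A *ᵥ v = Aᴴ *ᵥ v := by rw [hA.1.eq]
    conv_lhs => rw [h1, hAP]
    have hg' : star g = g := by rw [hg, ← star_dotProduct_star, star_star]
    have h2 : star (A *ᵥ v) ⬝ᵥ v = star v ⬝ᵥ A *ᵥ v := by
      rw [star_mulVec, hA.1.eq, ← dotProduct_mulVec]
    rw [conjTranspose_smul, conjTranspose_vecMulVec, star_star, smul_mulVec, vecMulVec_mulVec, h2,
      star_inv₀, hg']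
    ext j; simp [mul_assoc, mul_comm]
  have hgr : g = ((∑ i, ‖v i‖ ^ 2 : ℝ) : ℂ) := by
    simp [hg, dotProduct, Complex.conj_mul']
  refine ⟨(∑ i, ‖v i‖ ^ 2)⁻¹ * ((∑ i, ‖v i‖ ^ 2)⁻¹ * hermForm A v), ?_, ?_⟩
  · have := hA.hermForm_nonneg v
    positivity
  · push_cast
    rw [hA.1.coe_hermForm]
    conv_lhs => rw [hAP, hvA, hgr]
    rw [smul_vecMulVec, smul_smul]
    push_cast
    rfl

/-- `V - V h hᴴ V / (hᴴ V h)` is positive semidefinite. -/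
lemma PosSemidef.sub_smul_vecMulVec {V : Matrix n n ℂ} (hV : V.PosSemidef) {h : n → ℂ}
    (hpos : 0 < hermForm V h) :
    (V - ((hermForm V h)⁻¹ : ℂ) • vecMulVec (V *ᵥ h) (star (V *ᵥ h))).PosSemidef := by
  classical
  set g : ℂ := (hermForm V h : ℂ) with hg
  have hg0 : g ≠ 0 := by rw [hg]; exact_mod_cast hpos.ne'
  have hgs : star g = g := by rw [hg, Complex.star_def, Complex.conj_ofReal]
  -- Congruence by the projection along `h` onto the `V`-orthogonal complement of `h`.
  have key := hV.conjTranspose_mul_mul_same (1 - g⁻¹ • vecMulVec h (star (V *ᵥ h)))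
  convert key using 1
  rw [conjTranspose_sub, conjTranspose_smul, conjTranspose_vecMulVec, star_inv₀, hgs, star_star,
    conjTranspose_one, sub_mul, sub_mul, mul_sub, mul_sub, one_mul, mul_one, mul_one, smul_mul_assoc,
    smul_mul_assoc, mul_smul_comm, mul_smul_comm, mul_vecMulVec, vecMulVec_mul (V *ᵥ h),
    vecMulVec_mul_vecMulVec]
  have e3 : star h ᵥ* V = star (V *ᵥ h) := by rw [star_mulVec, hV.1.eq]
  have e4 : star (V *ᵥ h) ⬝ᵥ h = g := by
    rw [hg, hV.1.coe_hermForm, star_mulVec, hV.1.eq, dotProduct_mulVec]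
  rw [e3, e4, vecMulVec_smul, smul_smul, smul_smul, mul_assoc, inv_mul_cancel₀ hg0, mul_one]
  abel

end Matrix

/-! ### Triangular factorization of positive semidefinite matrices -/

namespace Matrix

variable {M : ℕ}

/-- Lower triangular matrices with unit diagonal. -/
structure IsUnitLower (T : Matrix (Fin M) (Fin M) ℂ) : Prop where
  apply_lt : ∀ i j, i < j → T i j = 0
  apply_self : ∀ i, T i i = 1

namespace IsUnitLower

variable {T : Matrix (Fin M) (Fin M) ℂ}

lemma det_eq_one (hT : T.IsUnitLower) : T.det = 1 := by
  rw [det_of_isLowerTriangular T fun i j hij => hT.apply_lt _ _ hij]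
  simp [hT.apply_self]

lemma mul_inv (hT : T.IsUnitLower) : T * T⁻¹ = 1 :=
  mul_nonsing_inv T (by simp [hT.det_eq_one])

lemma inv_mul (hT : T.IsUnitLower) : T⁻¹ * T = 1 :=
  nonsing_inv_mul T (by simp [hT.det_eq_one])

/-- Multiplication by `T` keeps the first entry that may be nonzero. -/
lemma mulVec_apply (hT : T.IsUnitLower) {x : Fin M → ℂ} {m : Fin M} (hx : ∀ i < m, x i = 0) :
    (T *ᵥ x) m = x m := by
  rw [mulVec, dotProduct, Finset.sum_eq_single m]
  · rw [hT.apply_self, one_mul]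
  · intro j _ hj
    rcases lt_or_gt_of_ne hj with h | h
    · rw [hx j h, mul_zero]
    · rw [hT.apply_lt _ _ h, zero_mul]
  · simp

protected lemma inv (hT : T.IsUnitLower) : T⁻¹.IsUnitLower := by
  let _ : Invertible T := invertibleOfIsUnitDet T (by simp [hT.det_eq_one])
  have hl : ∀ i j, i < j → T⁻¹ i j = 0 := fun i j hij =>
    blockTriangular_inv_of_blockTriangular
      (show T.BlockTriangular OrderDual.toDual from fun i j hij => hT.apply_lt _ _ hij) hij
  refine ⟨hl, fun i => ?_⟩
  have h := hT.mulVec_apply (x := T⁻¹.col i) (m := i) fun j hj => hl j i hj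
  rw [← mulVec_single_one, mulVec_mulVec, hT.mul_inv] at h
  simpa using h.symm

end IsUnitLower

open scoped MatrixOrder in
lemma PosSemidef.exists_eq_conjTranspose_mul_self {n : Type*} [Fintype n] {Q : Matrix n n ℂ}
    (hQ : Q.PosSemidef) : ∃ C : Matrix n n ℂ, Q = Cᴴ * C := by
  classical
  exact CStarAlgebra.nonneg_iff_eq_star_mul_self.1 (nonneg_iff_posSemidef.2 hQ)

/-- The residual of the `m`-th coordinate after regression on the later ones. -/
lemma PosSemidef.exists_residual {Q : Matrix (Fin M) (Fin M) ℂ} (hQ : Q.PosSemidef) (m : Fin M) :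
    ∃ a : Fin M → ℂ, (∀ i < m, a i = 0) ∧ a m = 1 ∧ ∀ i, m < i → (Q *ᵥ a) i = 0 := by
  obtain ⟨C, rfl⟩ := hQ.exists_eq_conjTranspose_mul_self
  let L := toLpLin 2 2 C
  -- `S` is the space of vectors supported strictly after `m`. Projecting `C e_m` onto `C S`
  -- performs the regression, and its normal equations are the last claim.
  let S : Submodule ℂ (EuclideanSpace ℂ (Fin M)) :=
    { carrier := {x | ∀ i ≤ m, x i = 0}
      add_mem' := fun hx hy i hi => by simp [hx i hi, hy i hi]
      zero_mem' := fun i _ => rfl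
      smul_mem' := fun c x hx i hi => by simp [hx i hi] }
  let W := S.map L
  obtain ⟨y, hy, hyW⟩ := W.starProjection_apply_mem (L (EuclideanSpace.single m 1))
  have horth := W.sub_starProjection_mem_orthogonal (L (EuclideanSpace.single m 1))
  rw [← hyW, ← map_sub] at horth
  refine ⟨(EuclideanSpace.single m 1 - y).ofLp, fun i hi => ?_, ?_, fun i hi => ?_⟩
  · simp [hy i hi.le, hi.ne]
  · simp [hy m le_rfl]
  · have h := (Submodule.mem_orthogonal _ _).1 horth (L (EuclideanSpace.single i 1))
      ⟨_, fun j hj => by simp [(hj.trans_lt hi).ne], rfl⟩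
    rw [EuclideanSpace.inner_eq_star_dotProduct] at h
    simp only [L, ofLp_toLpLin, toLin'_apply] at h
    rw [dotProduct_comm, star_mulVec, ← dotProduct_mulVec, mulVec_mulVec] at h
    simpa using h

/-- If every column `a` of `T⁻¹` satisfies `(Q a)_i = 0` below its diagonal position, then `Q` has
the factorization `Tᴴ D T`. -/
lemma PosSemidef.eq_of_residual {Q T : Matrix (Fin M) (Fin M) ℂ} (hQ : Q.PosSemidef)
    (hT : T.IsUnitLower) (h : ∀ m i, m < i → (Q *ᵥ T⁻¹.col m) i = 0) :
    ∃ d : Fin M → ℝ, 0 ≤ d ∧ Q = Tᴴ * diagonal (fun i => (d i : ℂ)) * T := by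
  set D := (T⁻¹)ᴴ * Q * T⁻¹ with hD
  have hDp : D.PosSemidef := hQ.conjTranspose_mul_mul_same _
  -- Column `i` of `T⁻¹` lives on indices `≥ i`, and `Q` times column `j` on indices `≤ j`.
  have hlow : ∀ i j, j < i → D i j = 0 := fun i j hij => by
    have : D i j = star (T⁻¹.col i) ⬝ᵥ (Q *ᵥ T⁻¹.col j) := by
      rw [hD, Matrix.mul_assoc, mul_apply]
      rfl
    rw [this, dotProduct]
    refine Finset.sum_eq_zero fun l _ => ?_
    rcases lt_or_ge l i with hl | hl
    · simp [hT.inv.apply_lt _ _ hl]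
    · rw [h j l (hij.trans_le hl), mul_zero]
  refine ⟨fun i => (D i i).re, fun i => hDp.re_diag_nonneg i, ?_⟩
  have hdiag : (diagonal fun i => ((D i i).re : ℂ)) = D := by
    ext i j
    rcases lt_trichotomy i j with hij | rfl | hij
    · rw [diagonal_apply_ne _ hij.ne, ← hDp.1.apply, hlow _ _ hij, star_zero]
    · rw [diagonal_apply_eq]
      exact hDp.1.coe_re_apply_self i
    · rw [diagonal_apply_ne _ hij.ne', hlow _ _ hij]
  have h1 : Tᴴ * (T⁻¹)ᴴ = 1 := by rw [← conjTranspose_mul, hT.inv_mul, conjTranspose_one]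
  rw [hdiag, hD, show Tᴴ * ((T⁻¹)ᴴ * Q * T⁻¹) * T = Tᴴ * (T⁻¹)ᴴ * Q * (T⁻¹ * T) by
    simp only [Matrix.mul_assoc], h1, hT.inv_mul, Matrix.mul_one, Matrix.one_mul]

/-- A factorization `Q = Tᴴ D T` with `T` unit lower triangular and `D ≥ 0` diagonal. -/
lemma PosSemidef.exists_factorization {Q : Matrix (Fin M) (Fin M) ℂ} (hQ : Q.PosSemidef) :
    ∃ T : Matrix (Fin M) (Fin M) ℂ, T.IsUnitLower ∧
      ∃ d : Fin M → ℝ, 0 ≤ d ∧ Q = Tᴴ * diagonal (fun i => (d i : ℂ)) * T := by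
  choose a ha0 ha1 ha using hQ.exists_residual
  -- The residual vectors are to be the columns of `T⁻¹`, so `T` is the inverse of this matrix.
  have hB : (of fun i j => a j i).IsUnitLower :=
    ⟨fun i j hij => ha0 j i hij, fun i => ha1 i⟩
  refine ⟨_, hB.inv, hQ.eq_of_residual hB.inv fun m i hmi => ?_⟩
  rw [nonsing_inv_nonsing_inv _ (by simp [hB.det_eq_one])]
  exact ha m i hmi

lemma posSemidef_factorization (T : Matrix (Fin M) (Fin M) ℂ) {d : Fin M → ℝ} (hd : 0 ≤ d) :
    (Tᴴ * diagonal (fun i => (d i : ℂ)) * T).PosSemidef :=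
  (PosSemidef.diagonal fun i => by simpa using hd i).conjTranspose_mul_mul_same T

/-- With `T` fixed, entrywise order of the diagonals gives Loewner order of the products. -/
lemma factorization_sub (T : Matrix (Fin M) (Fin M) ℂ) (d e : Fin M → ℝ) :
    Tᴴ * diagonal (fun i => (d i : ℂ)) * T - Tᴴ * diagonal (fun i => (e i : ℂ)) * T =
      Tᴴ * diagonal (fun i => ((d - e) i : ℂ)) * T := by
  rw [← Matrix.sub_mul, ← Matrix.mul_sub, diagonal_sub]
  simp

/-- `T` sends this column to `e_m`. These columns serve as test vectors in the fronthaul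
constraints. -/
lemma IsUnitLower.hermForm_col_inv {T : Matrix (Fin M) (Fin M) ℂ} (hT : T.IsUnitLower)
    (d : Fin M → ℝ) (m : Fin M) :
    hermForm (Tᴴ * diagonal (fun i => (d i : ℂ)) * T) (T⁻¹.col m) = d m := by
  rw [hermForm_conjTranspose_mul_mul, hermForm_diagonal, ← mulVec_single_one, mulVec_mulVec,
    hT.mul_inv, one_mulVec, Finset.sum_eq_single m] <;> simp +contextual

end Matrix

/-! ### Monotonicity and the constraints as quadratic forms -/

namespace Network

open Matrix

variable {M K : ℕ} {N : Network M K} {V V' : Fin K → Matrix (Fin M) (Fin M) ℂ}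
  {Q Q' : Matrix (Fin M) (Fin M) ℂ} {μ : EuclideanSpace ℝ (Fin M)}

lemma gain_eq_hermForm (N : Network M K) (A : Matrix (Fin M) (Fin M) ℂ) (k : Fin K) :
    N.gain A k = hermForm A (N.h k) := by
  rw [gain, mul_vecMulVec, trace_vecMulVec, dotProduct_comm, hermForm]

lemma antennaPower_eq (V : Fin K → Matrix (Fin M) (Fin M) ℂ) (Q : Matrix (Fin M) (Fin M) ℂ)
    (m : Fin M) : antennaPower V Q m = ∑ k, (V k m m).re + (Q m m).re := by
  simp [antennaPower]

/-- Since `(γ + 1) / γ = 1 + 1 / γ`, user `k`'s own term cancels from the sum; what remains is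
increasing in the gain of `V k` and decreasing in all others. -/
lemma sinrSlack_eq (hγ : ∀ k, 0 < N.γ k) (k : Fin K) :
    N.sinrSlack V Q k = N.gain (V k) k / N.γ k - ∑ j ∈ Finset.univ.erase k, N.gain (V j) k
      - N.gain Q k - N.σ k ^ 2 := by
  rw [sinrSlack, ← Finset.add_sum_erase _ _ (Finset.mem_univ k)]
  have := (hγ k).ne'
  field_simp
  ring

/-- Keeping the useful signal and lowering the interference increases the SINR slack. -/
lemma sinrSlack_mono (hγ : ∀ k, 0 < N.γ k) {k : Fin K} (hk : N.gain (V' k) k = N.gain (V k) k)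
    (hV : ∀ j, N.gain (V' j) k ≤ N.gain (V j) k) (hQ : N.gain Q' k ≤ N.gain Q k) :
    N.sinrSlack V Q k ≤ N.sinrSlack V' Q' k := by
  rw [sinrSlack_eq hγ, sinrSlack_eq hγ, hk]
  have := Finset.sum_le_sum fun j (_ : j ∈ Finset.univ.erase k) => hV j
  linarith

lemma gain_le_of_posSemidef_sub {A B : Matrix (Fin M) (Fin M) ℂ} (h : (A - B).PosSemidef)
    (k : Fin K) : N.gain B k ≤ N.gain A k := by
  have := h.hermForm_nonneg (N.h k)
  rw [hermForm_sub] at this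
  rw [gain_eq_hermForm, gain_eq_hermForm]
  linarith

lemma antennaPower_le_of_posSemidef_sub (hV : ∀ k, (V k - V' k).PosSemidef)
    (hQ : (Q - Q').PosSemidef) (m : Fin M) : antennaPower V' Q' m ≤ antennaPower V Q m := by
  rw [antennaPower_eq, antennaPower_eq]
  refine add_le_add (Finset.sum_le_sum fun k _ => ?_) ?_
  · simpa using (hV k).re_diag_nonneg m
  · simpa using hQ.re_diag_nonneg m

lemma antennaPower_nonneg (hV : ∀ k, (V k).PosSemidef) (hQ : Q.PosSemidef) (m : Fin M) :
    0 ≤ antennaPower V Q m := by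
  rw [antennaPower_eq]
  exact add_nonneg (Finset.sum_nonneg fun k _ => (hV k).re_diag_nonneg m) (hQ.re_diag_nonneg m)

lemma isHermitian_fronthaulMatrix (hQ : Q.IsHermitian) (m : Fin M) :
    (N.fronthaulMatrix V Q m).IsHermitian := by
  have hB : (trailingBlock Q m).IsHermitian := IsHermitian.ext fun i j => by
    by_cases hi : m ≤ i <;> by_cases hj : m ≤ j <;> simp [trailingBlock, hi, hj, hQ.apply]
  refine IsHermitian.sub ?_ ?_
  · rw [IsHermitian, conjTranspose_smul, hB.eq, Complex.star_def, Complex.conj_ofReal]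
  · rw [IsHermitian, conjTranspose_single, Complex.star_def, Complex.conj_ofReal]

lemma hermForm_trailingBlock (Q : Matrix (Fin M) (Fin M) ℂ) (m : Fin M) (x : Fin M → ℂ) :
    hermForm (trailingBlock Q m) x = hermForm Q (fun i => if m ≤ i then x i else 0) := by
  simp only [hermForm, trailingBlock, dotProduct, mulVec, of_apply, Pi.star_apply]
  congr 1
  refine Finset.sum_congr rfl fun i _ => ?_
  by_cases hi : m ≤ i
  · simp only [hi, true_and, if_true]
    congr 1
    refine Finset.sum_congr rfl fun j _ => ?_
    split_ifs <;> simp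
  · simp [hi]

lemma hermForm_fronthaulMatrix (N : Network M K) (V : Fin K → Matrix (Fin M) (Fin M) ℂ)
    (Q : Matrix (Fin M) (Fin M) ℂ) (m : Fin M) (x : Fin M → ℂ) :
    hermForm (N.fronthaulMatrix V Q m) x =
      2 ^ N.C m * hermForm Q (fun i => if m ≤ i then x i else 0)
        - antennaPower V Q m * ‖x m‖ ^ 2 := by
  rw [fronthaulMatrix, hermForm_sub, hermForm_smul, hermForm_trailingBlock,
    ← diagonal_single]
  congr 1
  have : (Pi.single m ((antennaPower V Q m : ℝ) : ℂ) : Fin M → ℂ) =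
      fun i => ((Pi.single m (antennaPower V Q m) : Fin M → ℝ) i : ℂ) := by
    ext i; by_cases h : i = m
    · subst h; simp
    · simp [h]
  rw [this, hermForm_diagonal, Finset.sum_eq_single m] <;> simp +contextual

lemma hermForm_fronthaulMatrix_of_support {m : Fin M} {x : Fin M → ℂ} (hx : ∀ i < m, x i = 0) :
    hermForm (N.fronthaulMatrix V Q m) x =
      2 ^ N.C m * hermForm Q x - antennaPower V Q m * ‖x m‖ ^ 2 := by
  rw [hermForm_fronthaulMatrix]
  congr 4
  ext i
  split_ifs with h
  · rfl
  · exact (hx i (not_le.1 h)).symm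

/-- If the antenna power `m` is at most `2 ^ C_m d_m`, the fronthaul constraint `m` holds for
`Q = Tᴴ D T`. -/
lemma posSemidef_fronthaulMatrix {T : Matrix (Fin M) (Fin M) ℂ} (hT : T.IsUnitLower)
    {d : Fin M → ℝ} (hd : 0 ≤ d) {m : Fin M}
    (h : antennaPower V (Tᴴ * diagonal (fun i => (d i : ℂ)) * T) m ≤ 2 ^ N.C m * d m) :
    (N.fronthaulMatrix V (Tᴴ * diagonal (fun i => (d i : ℂ)) * T) m).PosSemidef := by
  have hF := isHermitian_fronthaulMatrix (N := N) (V := V) (posSemidef_factorization T hd).1 m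
  refine hF.posSemidef_of_hermForm_nonneg fun x => ?_
  rw [hermForm_fronthaulMatrix, hermForm_conjTranspose_mul_mul, hermForm_diagonal]
  set y : Fin M → ℂ := fun i => if m ≤ i then x i else 0
  have hy : (T *ᵥ y) m = x m := by
    rw [hT.mulVec_apply fun i hi => if_neg (not_le.2 hi)]
    exact if_pos le_rfl
  -- The `m`-th term alone suffices: `y` vanishes before `m`, so `T` leaves its entry `m` unchanged.
  have h1 : d m * ‖x m‖ ^ 2 ≤ ∑ i, d i * ‖(T *ᵥ y) i‖ ^ 2 := by
    rw [← hy]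
    exact Finset.single_le_sum (f := fun i => d i * ‖(T *ᵥ y) i‖ ^ 2)
      (fun i _ => mul_nonneg (hd i) (sq_nonneg _)) (Finset.mem_univ m)
  have h2 : (0 : ℝ) ≤ 2 ^ N.C m := by positivity
  nlinarith [mul_le_mul_of_nonneg_left h1 h2, mul_le_mul_of_nonneg_right h (sq_nonneg ‖x m‖)]

/-- The fronthaul constraint tested on a vector `a` with first nonzero entry `a_m = 1`. -/
lemma antennaPower_le_of_fronthaul {m : Fin M} (h : (N.fronthaulMatrix V Q m).PosSemidef)
    {a : Fin M → ℂ} (ha : ∀ i < m, a i = 0) (ham : a m = 1) :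
    antennaPower V Q m ≤ 2 ^ N.C m * hermForm Q a := by
  have := h.hermForm_nonneg a
  rw [hermForm_fronthaulMatrix_of_support ha, ham] at this
  simpa using this

/-- If that test is tight, then `a` is a residual vector of `Q`. -/
lemma mulVec_eq_zero_of_fronthaul {m : Fin M} (h : (N.fronthaulMatrix V Q m).PosSemidef)
    {a : Fin M → ℂ} (ha : ∀ i < m, a i = 0) (ham : a m = 1)
    (heq : 2 ^ N.C m * hermForm Q a ≤ antennaPower V Q m) {i : Fin M} (hi : m < i) :
    (Q *ᵥ a) i = 0 := by
  -- Tightness puts `a` in the kernel of the fronthaul matrix; rows after `m` of that equation do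
  -- not see `E_m`.
  have h0 := h.mulVec_eq_zero_of_hermForm (x := a) (by
    rw [hermForm_fronthaulMatrix_of_support ha, ham]; simpa using heq)
  have h1 := congrFun h0 i
  rw [fronthaulMatrix, sub_mulVec, smul_mulVec] at h1
  have h2 : (Matrix.single m m ((antennaPower V Q m : ℝ) : ℂ) *ᵥ a) i = 0 := by
    simp [single_mulVec, Function.update_of_ne hi.ne']
  have h3 : (trailingBlock Q m *ᵥ a) i = (Q *ᵥ a) i := by
    simp only [mulVec, dotProduct, trailingBlock, of_apply, hi.le, true_and]
    refine Finset.sum_congr rfl fun j _ => ?_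
    split_ifs with hj
    · rfl
    · simp [ha j (not_le.1 hj)]
  rw [Pi.sub_apply, h2, sub_zero, Pi.smul_apply, h3, smul_eq_mul, Pi.zero_apply] at h1
  refine (mul_eq_zero.1 h1).resolve_left ?_
  exact_mod_cast (Real.rpow_pos_of_pos two_pos _).ne'

end Network

/-! ### Structure and uniqueness of solutions -/

namespace Network

open Matrix

variable {M K : ℕ} {N : Network M K} {V V' : Fin K → Matrix (Fin M) (Fin M) ℂ}
  {Q Q' : Matrix (Fin M) (Fin M) ℂ} {μ : EuclideanSpace ℝ (Fin M)}

/-- A feasible point below a solution in the Loewner order is that solution. -/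
lemma IsSolution.eq_of_posSemidef_sub (hμ : ∀ m, 0 < 1 + μ m) (hS : N.IsSolution μ V Q)
    (hF : N.Feasible V' Q') (hV : ∀ k, (V k - V' k).PosSemidef) (hQ : (Q - Q').PosSemidef) :
    V' = V ∧ Q' = Q := by
  have hle := antennaPower_le_of_posSemidef_sub hV hQ
  -- A strict drop at a single antenna would lower the objective.
  have heq : ∀ m, antennaPower V Q m = antennaPower V' Q' m := by
    intro m
    by_contra hne
    refine (hS.2 _ _ hF).not_gt (Finset.sum_lt_sum (fun i _ => ?_) ⟨m, Finset.mem_univ m, ?_⟩)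
    · exact mul_le_mul_of_nonneg_left (hle i) (hμ i).le
    · exact mul_lt_mul_of_pos_left (lt_of_le_of_ne (hle m) (Ne.symm hne)) (hμ m)
  have hsum : ∀ m, ∑ k, ((V k - V' k) m m).re + ((Q - Q') m m).re = 0 := fun m => by
    have := heq m
    rw [antennaPower_eq, antennaPower_eq] at this
    simp only [Matrix.sub_apply, Complex.sub_re, Finset.sum_sub_distrib]
    linarith
  have hnn : ∀ m, 0 ≤ ∑ k, ((V k - V' k) m m).re := fun m =>
    Finset.sum_nonneg fun k _ => (hV k).re_diag_nonneg m
  constructor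
  · ext1 k
    refine (sub_eq_zero.1 ((hV k).eq_zero_of_re_diag fun m => ?_)).symm
    have h0 : ∑ k, ((V k - V' k) m m).re = 0 :=
      le_antisymm (by linarith [hsum m, hQ.re_diag_nonneg m]) (hnn m)
    exact (Finset.sum_eq_zero_iff_of_nonneg fun k _ => (hV k).re_diag_nonneg m).1 h0 k
      (Finset.mem_univ k)
  · refine (sub_eq_zero.1 (hQ.eq_zero_of_re_diag fun m => ?_)).symm
    exact le_antisymm (by linarith [hsum m, hnn m]) (hQ.re_diag_nonneg m)

/-- Interference is nonnegative and noise positive, so the signal cannot vanish; this permits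
division by `hᴴ V k h`. -/
lemma Feasible.gain_pos (hσ : ∀ k, 0 < N.σ k) (hγ : ∀ k, 0 < N.γ k) (h : N.Feasible V Q)
    (k : Fin K) : 0 < N.gain (V k) k := by
  have h1 := h.sinr k
  rw [sinrSlack_eq hγ] at h1
  have h2 : 0 ≤ ∑ j ∈ Finset.univ.erase k, N.gain (V j) k := Finset.sum_nonneg fun j _ => by
    rw [gain_eq_hermForm]; exact (h.posSemidef_V j).hermForm_nonneg _
  have h3 : 0 ≤ N.gain Q k := by
    rw [gain_eq_hermForm]; exact h.posSemidef_Q.hermForm_nonneg _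
  have h4 : 0 < N.gain (V k) k / N.γ k := by linarith [pow_pos (hσ k) 2]
  exact (div_pos_iff_of_pos_right (hγ k)).1 h4

/-- Lowering the `V_k` in the Loewner order without changing the useful signals keeps
feasibility. -/
lemma Feasible.of_posSemidef_sub (hγ : ∀ k, 0 < N.γ k) (h : N.Feasible V Q)
    (hV' : ∀ k, (V' k).PosSemidef) (hV : ∀ k, (V k - V' k).PosSemidef)
    (hg : ∀ k, N.gain (V' k) k = N.gain (V k) k) : N.Feasible V' Q := by
  refine ⟨hV', h.posSemidef_Q, fun k => ?_, fun m => ?_⟩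
  · exact (h.sinr k).trans
      (sinrSlack_mono hγ (hg k) (fun j => gain_le_of_posSemidef_sub (hV j) k) le_rfl)
  · have hp : antennaPower V' Q m ≤ antennaPower V Q m :=
      antennaPower_le_of_posSemidef_sub hV (by rw [sub_self]; exact .zero) m
    have hF := isHermitian_fronthaulMatrix (N := N) (V := V') h.posSemidef_Q.1 m
    refine hF.posSemidef_of_hermForm_nonneg fun x => ?_
    have := (h.fronthaul m).hermForm_nonneg x
    rw [hermForm_fronthaulMatrix] at this ⊢
    nlinarith [mul_le_mul_of_nonneg_right hp (sq_nonneg ‖x m‖)]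

/-- The beamforming covariances of a solution have rank one. -/
lemma IsSolution.exists_eq_vecMulVec (hσ : ∀ k, 0 < N.σ k) (hγ : ∀ k, 0 < N.γ k)
    (hμ : ∀ m, 0 < 1 + μ m) (hS : N.IsSolution μ V Q) (k : Fin K) :
    ∃ v : Fin M → ℂ, V k = vecMulVec v (star v) := by
  have hg : ∀ k, 0 < hermForm (V k) (N.h k) := fun k => by
    rw [← gain_eq_hermForm]; exact hS.1.gain_pos hσ hγ k
  have hrank : ∀ k, ∃ v : Fin M → ℂ, vecMulVec v (star v) =
      ((hermForm (V k) (N.h k))⁻¹ : ℂ) • vecMulVec (V k *ᵥ N.h k) (star (V k *ᵥ N.h k)) := fun k => by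
    refine ⟨(((√(hermForm (V k) (N.h k)))⁻¹ : ℝ) : ℂ) • (V k *ᵥ N.h k), ?_⟩
    rw [star_smul, smul_vecMulVec, vecMulVec_smul, smul_smul, Complex.star_def, Complex.conj_ofReal,
      ← Complex.ofReal_mul, ← mul_inv, Real.mul_self_sqrt (hg k).le, Complex.ofReal_inv]
  choose v hv using hrank
  have hsub : ∀ k, (V k - vecMulVec (v k) (star (v k))).PosSemidef := fun k => by
    rw [hv]; exact (hS.1.posSemidef_V k).sub_smul_vecMulVec (hg k)
  have hF : N.Feasible (fun k => vecMulVec (v k) (star (v k))) Q := by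
    refine hS.1.of_posSemidef_sub hγ (fun k => posSemidef_vecMulVec_self_star _) hsub fun k => ?_
    rw [gain_eq_hermForm, gain_eq_hermForm, hv, ← Complex.ofReal_inv, hermForm_smul,
      hermForm_vecMulVec, star_mulVec, (hS.1.posSemidef_V k).1.eq, ← dotProduct_mulVec,
      ← (hS.1.posSemidef_V k).1.coe_hermForm, Complex.norm_real, Real.norm_eq_abs, sq_abs]
    field_simp
  have h := hS.eq_of_posSemidef_sub hμ hF hsub (by rw [sub_self]; exact .zero)
  exact ⟨v k, (congrFun h.1 k).symm⟩

/-- The fronthaul constraints are tight at a solution. -/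
lemma IsSolution.antennaPower_eq_of_factorization (hγ : ∀ k, 0 < N.γ k) (hμ : ∀ m, 0 < 1 + μ m)
    {T : Matrix (Fin M) (Fin M) ℂ} (hT : T.IsUnitLower) {d : Fin M → ℝ}
    (hS : N.IsSolution μ V (Tᴴ * diagonal (fun i => (d i : ℂ)) * T)) (m : Fin M) :
    antennaPower V (Tᴴ * diagonal (fun i => (d i : ℂ)) * T) m = 2 ^ N.C m * d m := by
  set Q := Tᴴ * diagonal (fun i => (d i : ℂ)) * T with hQ
  have hc : ∀ m, (0 : ℝ) < 2 ^ N.C m := fun m => Real.rpow_pos_of_pos two_pos _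
  have hle : ∀ m, antennaPower V Q m ≤ 2 ^ N.C m * d m := fun m => by
    have := antennaPower_le_of_fronthaul (hS.1.fronthaul m) (a := T⁻¹.col m)
      (fun i hi => hT.inv.apply_lt i m hi) (hT.inv.apply_self m)
    rwa [hQ, hT.hermForm_col_inv, ← hQ] at this
  -- The least diagonal allowed by the present powers. Passing to it can only lower those powers, so
  -- the new point still satisfies the constraints.
  set e : Fin M → ℝ := fun m => antennaPower V Q m / 2 ^ N.C m with he
  have he0 : 0 ≤ e := fun m =>
    div_nonneg (antennaPower_nonneg hS.1.posSemidef_V hS.1.posSemidef_Q m) (hc m).le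
  have hed : 0 ≤ d - e := fun m => sub_nonneg.2 ((div_le_iff₀' (hc m)).2 (hle m))
  set Q' := Tᴴ * diagonal (fun i => (e i : ℂ)) * T with hQ'
  have hsub : (Q - Q').PosSemidef := by
    rw [hQ, hQ', factorization_sub]
    exact posSemidef_factorization T hed
  have hV0 : ∀ k, (V k - V k).PosSemidef := fun k => by rw [sub_self]; exact .zero
  have hF : N.Feasible V Q' := by
    refine ⟨hS.1.posSemidef_V, posSemidef_factorization T he0, fun k => (hS.1.sinr k).trans ?_,
      fun m => posSemidef_fronthaulMatrix hT he0 ?_⟩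
    · exact sinrSlack_mono hγ rfl (fun _ => le_rfl) (gain_le_of_posSemidef_sub hsub k)
    · refine (antennaPower_le_of_posSemidef_sub hV0 hsub m).trans ?_
      simp only [he]
      rw [mul_div_cancel₀ _ (hc m).ne']
  have h := (hS.eq_of_posSemidef_sub hμ hF hV0 hsub).2
  have hde : e m = d m := by
    rw [← hT.hermForm_col_inv e m, ← hT.hermForm_col_inv d m, ← hQ, ← hQ', h]
  rw [← hde]
  simp only [he]
  rw [mul_div_cancel₀ _ (hc m).ne']

lemma antennaPower_midpoint (m : Fin M) :
    antennaPower (fun k => ((2⁻¹ : ℝ) : ℂ) • (V k + V' k)) (((2⁻¹ : ℝ) : ℂ) • (Q + Q')) m =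
      2⁻¹ * (antennaPower V Q m + antennaPower V' Q' m) := by
  simp only [antennaPower_eq, Matrix.smul_apply, Matrix.add_apply, smul_eq_mul,
    Complex.re_ofReal_mul, Complex.add_re, ← Finset.mul_sum, Finset.sum_add_distrib]
  ring

lemma gain_midpoint (N : Network M K) (A B : Matrix (Fin M) (Fin M) ℂ) (k : Fin K) :
    N.gain (((2⁻¹ : ℝ) : ℂ) • (A + B)) k = 2⁻¹ * (N.gain A k + N.gain B k) := by
  simp only [gain_eq_hermForm, hermForm_smul, hermForm_add]

lemma posSemidef_midpoint {A B : Matrix (Fin M) (Fin M) ℂ} (hA : A.PosSemidef)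
    (hB : B.PosSemidef) : (((2⁻¹ : ℝ) : ℂ) • (A + B)).PosSemidef :=
  (hA.add hB).smul (by simp)

/-- Every constraint is affine in `(V, Q)`, including the positive semidefinite ones after testing
on a vector. -/
lemma Feasible.midpoint (h : N.Feasible V Q) (h' : N.Feasible V' Q') :
    N.Feasible (fun k => ((2⁻¹ : ℝ) : ℂ) • (V k + V' k)) (((2⁻¹ : ℝ) : ℂ) • (Q + Q')) := by
  have hQ := posSemidef_midpoint h.posSemidef_Q h'.posSemidef_Q
  refine ⟨fun k => posSemidef_midpoint (h.posSemidef_V k) (h'.posSemidef_V k), hQ,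
    fun k => ?_, fun m => ?_⟩
  · have h1 := h.sinr k
    have h2 := h'.sinr k
    simp only [sinrSlack, gain_midpoint, ← Finset.mul_sum, Finset.sum_add_distrib] at *
    linarith
  · refine (isHermitian_fronthaulMatrix hQ.1 m).posSemidef_of_hermForm_nonneg fun x => ?_
    have h1 := (h.fronthaul m).hermForm_nonneg x
    have h2 := (h'.fronthaul m).hermForm_nonneg x
    simp only [hermForm_fronthaulMatrix, antennaPower_midpoint, hermForm_smul, hermForm_add] at *
    linarith

lemma IsSolution.midpoint (h : N.IsSolution μ V Q) (h' : N.IsSolution μ V' Q') :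
    N.IsSolution μ (fun k => ((2⁻¹ : ℝ) : ℂ) • (V k + V' k)) (((2⁻¹ : ℝ) : ℂ) • (Q + Q')) := by
  refine ⟨h.1.midpoint h'.1, fun W R hF => ?_⟩
  have h1 := h.2 _ _ hF
  have h2 := h'.2 _ _ hF
  simp only [weightedPower, antennaPower_midpoint, mul_left_comm _ (2⁻¹ : ℝ), mul_add,
    Finset.sum_add_distrib, ← Finset.mul_sum] at *
  linarith

/-- Two solutions have the same directions: only the scalings can differ. -/
lemma IsSolution.exists_common_factorization (hσ : ∀ k, 0 < N.σ k) (hγ : ∀ k, 0 < N.γ k)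
    (hμ : ∀ m, 0 < 1 + μ m) (h : N.IsSolution μ V Q) (h' : N.IsSolution μ V' Q') :
    ∃ (v : Fin K → Fin M → ℂ) (T : Matrix (Fin M) (Fin M) ℂ), T.IsUnitLower ∧
      (∃ (t : Fin K → ℝ) (d : Fin M → ℝ), 0 ≤ t ∧ 0 ≤ d ∧
        V = (fun k => (t k : ℂ) • vecMulVec (v k) (star (v k))) ∧
        Q = Tᴴ * diagonal (fun i => (d i : ℂ)) * T) ∧
      ∃ (t : Fin K → ℝ) (d : Fin M → ℝ), 0 ≤ t ∧ 0 ≤ d ∧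
        V' = (fun k => (t k : ℂ) • vecMulVec (v k) (star (v k))) ∧
        Q' = Tᴴ * diagonal (fun i => (d i : ℂ)) * T := by
  have hm := h.midpoint h'
  choose v hv using hm.exists_eq_vecMulVec hσ hγ hμ
  obtain ⟨T, hT, d, hd, hQ⟩ := hm.1.posSemidef_Q.exists_factorization
  -- `A / 2` lies below the rank-one midpoint because `B / 2` is positive semidefinite.
  have key : ∀ {A B : Matrix (Fin M) (Fin M) ℂ} {u : Fin M → ℂ}, A.PosSemidef → B.PosSemidef →
      ((2⁻¹ : ℝ) : ℂ) • (A + B) = vecMulVec u (star u) →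
      ∃ t : ℝ, 0 ≤ t ∧ A = (t : ℂ) • vecMulVec u (star u) := by
    intro A B u hA hB hAB
    have h2 : (0 : ℂ) ≤ ((2⁻¹ : ℝ) : ℂ) := by simp
    obtain ⟨t, ht, hAt⟩ := (hA.smul h2).eq_smul_vecMulVec (v := u)
      (by rw [← hAB, smul_add, add_sub_cancel_left]; exact hB.smul h2)
    refine ⟨2 * t, by positivity, ?_⟩
    rw [Complex.ofReal_mul, mul_smul, ← hAt, smul_smul, ← Complex.ofReal_mul]
    norm_num
  have ha : ∀ m i, i < m → T⁻¹.col m i = 0 := fun m i hi => hT.inv.apply_lt i m hi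
  have ha1 : ∀ m, T⁻¹.col m m = 1 := fun m => hT.inv.apply_self m
  -- Tightness at the midpoint is the sum of the one-sided bounds `hle` and `hle'` below, so both
  -- are equalities and the columns of `T⁻¹` are residual vectors of `Q` and of `Q'`.
  have htight : ∀ m, antennaPower V Q m + antennaPower V' Q' m =
      2 ^ N.C m * (hermForm Q (T⁻¹.col m) + hermForm Q' (T⁻¹.col m)) := fun m => by
    have h1 : hermForm (((2⁻¹ : ℝ) : ℂ) • (Q + Q')) (T⁻¹.col m) = d m := by
      rw [hQ, hT.hermForm_col_inv]
    rw [hermForm_smul, hermForm_add] at h1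
    have h2 := hm
    rw [hQ] at h2
    have h3 := h2.antennaPower_eq_of_factorization hγ hμ hT m
    rw [← hQ, antennaPower_midpoint, ← h1] at h3
    linarith
  have hle := fun m => antennaPower_le_of_fronthaul (h.1.fronthaul m) (ha m) (ha1 m)
  have hle' := fun m => antennaPower_le_of_fronthaul (h'.1.fronthaul m) (ha m) (ha1 m)
  choose t ht hVt using fun k => key (h.1.posSemidef_V k) (h'.1.posSemidef_V k) (hv k)
  choose t' ht' hVt' using fun k => key (h'.1.posSemidef_V k) (h.1.posSemidef_V k)
    (by rw [add_comm]; exact hv k)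
  obtain ⟨e, he, hQe⟩ := h.1.posSemidef_Q.eq_of_residual hT fun m i hi =>
    mulVec_eq_zero_of_fronthaul (h.1.fronthaul m) (ha m) (ha1 m)
      (by linarith [htight m, hle' m]) hi
  obtain ⟨e', he', hQe'⟩ := h'.1.posSemidef_Q.eq_of_residual hT fun m i hi =>
    mulVec_eq_zero_of_fronthaul (h'.1.fronthaul m) (ha m) (ha1 m)
      (by linarith [htight m, hle m]) hi
  exact ⟨v, T, hT, ⟨t, e, ht, he, funext hVt, hQe⟩, ⟨t', e', ht', he', funext hVt', hQe'⟩⟩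

/-- The weighted power minimization problem with positive weights has at most one solution. -/
theorem IsSolution.unique (hσ : ∀ k, 0 < N.σ k) (hγ : ∀ k, 0 < N.γ k) (hμ : ∀ m, 0 < 1 + μ m)
    (h : N.IsSolution μ V Q) (h' : N.IsSolution μ V' Q') : V' = V ∧ Q' = Q := by
  obtain ⟨v, T, hT, ⟨t, d, ht, hd, rfl, rfl⟩, ⟨t', d', ht', hd', rfl, rfl⟩⟩ :=
    h.exists_common_factorization hσ hγ hμ h'
  have hW : ∀ k (s : ℝ), 0 ≤ s → ((s : ℂ) • vecMulVec (v k) (star (v k))).PosSemidef :=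
    fun k s hs => (posSemidef_vecMulVec_self_star _).smul (by exact_mod_cast hs)
  have hsub : ∀ k (s r : ℝ), r ≤ s → ((s : ℂ) • vecMulVec (v k) (star (v k)) -
      (r : ℂ) • vecMulVec (v k) (star (v k))).PosSemidef := fun k s r hs => by
    rw [← sub_smul, ← Complex.ofReal_sub]
    exact hW k _ (sub_nonneg.2 hs)
  have hQsub : ∀ e f : Fin M → ℝ, f ≤ e → (Tᴴ * diagonal (fun i => (e i : ℂ)) * T -
      Tᴴ * diagonal (fun i => (f i : ℂ)) * T).PosSemidef := fun e f hef => by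
    rw [factorization_sub]
    exact posSemidef_factorization T (sub_nonneg.2 hef)
  have hbound : ∀ e : Fin M → ℝ, ∀ W, N.Feasible W (Tᴴ * diagonal (fun i => (e i : ℂ)) * T) →
      ∀ m, antennaPower W (Tᴴ * diagonal (fun i => (e i : ℂ)) * T) m ≤ 2 ^ N.C m * e m :=
    fun e W hF m => by
      have := antennaPower_le_of_fronthaul (hF.fronthaul m) (a := T⁻¹.col m)
        (fun i hi => hT.inv.apply_lt i m hi) (hT.inv.apply_self m)
      rwa [hT.hermForm_col_inv] at this
  -- For each constraint, compare with the solution attaining the minimum of the one scaling that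
  -- helps it: that scaling is unchanged and the others do not grow.
  have hF : N.Feasible (fun k => (((t ⊓ t') k : ℝ) : ℂ) • vecMulVec (v k) (star (v k)))
      (Tᴴ * diagonal (fun i => (((d ⊓ d') i : ℝ) : ℂ)) * T) := by
    refine ⟨fun k => hW k _ (le_inf ht ht' k), posSemidef_factorization T (le_inf hd hd'),
      fun k => ?_, fun m => posSemidef_fronthaulMatrix hT (le_inf hd hd') ?_⟩
    · rcases le_total (t k) (t' k) with hk | hk
      · refine (h.1.sinr k).trans (sinrSlack_mono hγ ?_
          (fun j => gain_le_of_posSemidef_sub (hsub j _ _ (inf_le_left (a := t) j)) k)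
          (gain_le_of_posSemidef_sub (hQsub _ _ inf_le_left) k))
        rw [Pi.inf_apply, inf_of_le_left hk]
      · refine (h'.1.sinr k).trans (sinrSlack_mono hγ ?_
          (fun j => gain_le_of_posSemidef_sub (hsub j _ _ (inf_le_right (a := t) j)) k)
          (gain_le_of_posSemidef_sub (hQsub _ _ inf_le_right) k))
        rw [Pi.inf_apply, inf_of_le_right hk]
    · rcases le_total (d m) (d' m) with hk | hk
      · rw [Pi.inf_apply, inf_of_le_left hk]
        exact (antennaPower_le_of_posSemidef_sub (fun k => hsub k _ _ (inf_le_left (a := t) k))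
          (hQsub _ _ inf_le_left) m).trans (hbound d _ h.1 m)
      · rw [Pi.inf_apply, inf_of_le_right hk]
        exact (antennaPower_le_of_posSemidef_sub (fun k => hsub k _ _ (inf_le_right (a := t) k))
          (hQsub _ _ inf_le_right) m).trans (hbound d' _ h'.1 m)
  have e1 := h.eq_of_posSemidef_sub hμ hF (fun k => hsub k _ _ (inf_le_left (a := t) k))
    (hQsub _ _ inf_le_left)
  have e2 := h'.eq_of_posSemidef_sub hμ hF (fun k => hsub k _ _ (inf_le_right (a := t) k))
    (hQsub _ _ inf_le_right)
  exact ⟨e2.1.symm.trans e1.1, e2.2.symm.trans e1.2⟩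

end Network

/-! ### Minimizing linear functionals and Danskin's theorem -/

section SupportFunction

open Filter Topology

variable {M : ℕ} {P : Set (EuclideanSpace ℝ (Fin M))}

/-- For nonnegative `p`, a bound on `⟪w, p⟫` with weights `w ≥ δ` bounds the entries of `p`. -/
lemma EuclideanSpace.apply_le_of_inner_le {w p : EuclideanSpace ℝ (Fin M)} {δ B : ℝ} (hδ : 0 < δ)
    (hw : ∀ m, δ ≤ w m) (hp : ∀ m, 0 ≤ p m) (h : inner ℝ w p ≤ B) (m : Fin M) : p m ≤ B / δ := by
  rw [le_div_iff₀' hδ]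
  refine le_trans ?_ h
  rw [PiLp.inner_apply]
  refine (mul_le_mul_of_nonneg_right (hw m) (hp m)).trans ?_
  have := Finset.single_le_sum (f := fun i => w i * p i)
    (fun i _ => mul_nonneg (hδ.le.trans (hw i)) (hp i)) (Finset.mem_univ m)
  simpa [mul_comm] using this

lemma exists_pos_forall_le (w : EuclideanSpace ℝ (Fin M)) (hw : ∀ m, 0 < w m) :
    ∃ δ > 0, ∀ m, δ ≤ w m := by
  rcases isEmpty_or_nonempty (Fin M) with h | h
  · exact ⟨1, one_pos, fun m => h.elim m⟩
  · obtain ⟨i, hi⟩ := Finite.exists_min fun m => w m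
    exact ⟨w i, hw i, hi⟩

/-- A positive linear functional attains its infimum on a nonempty set of nonnegative vectors with
compact truncations. -/
lemma exists_isMinOn_inner (hne : P.Nonempty) (hnn : ∀ p ∈ P, ∀ m, 0 ≤ p m)
    (hcpt : ∀ c : ℝ, IsCompact (P ∩ {p | ∀ m, p m ≤ c})) {w : EuclideanSpace ℝ (Fin M)}
    (hw : ∀ m, 0 < w m) : ∃ p ∈ P, ∀ q ∈ P, inner ℝ w p ≤ inner ℝ w q := by
  obtain ⟨p₀, hp₀⟩ := hne
  obtain ⟨δ, hδ, hδw⟩ := exists_pos_forall_le w hw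
  have hin : ∀ q ∈ P, inner ℝ w q ≤ inner ℝ w p₀ →
      q ∈ P ∩ {p | ∀ m, p m ≤ inner ℝ w p₀ / δ} := fun q hq h =>
    ⟨hq, EuclideanSpace.apply_le_of_inner_le hδ hδw (hnn q hq) h⟩
  obtain ⟨p, hp, hmin⟩ := (hcpt (inner ℝ w p₀ / δ)).exists_isMinOn ⟨p₀, hin p₀ hp₀ le_rfl⟩
    (f := fun q => inner ℝ w q) (by fun_prop)
  refine ⟨p, hp.1, fun q hq => ?_⟩
  rcases le_total (inner ℝ w q) (inner ℝ w p₀) with h | h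
  · exact hmin (hin q hq h)
  · exact (hmin (hin p₀ hp₀ le_rfl)).trans h

lemma sInf_inner_eq {w p : EuclideanSpace ℝ (Fin M)} (hp : p ∈ P)
    (hmin : ∀ q ∈ P, inner ℝ w p ≤ inner ℝ w q) :
    sInf ((fun q => inner ℝ w q) '' P) = inner ℝ w p :=
  IsLeast.csInf_eq ⟨⟨p, hp, rfl⟩, by rintro _ ⟨q, hq, rfl⟩; exact hmin q hq⟩

/-- **Danskin's theorem** for the infimum of linear functionals: where the minimizer is unique, it
is the gradient of the infimum. -/
theorem hasGradientAt_sInf_inner (hnn : ∀ p ∈ P, ∀ m, 0 ≤ p m)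
    (hcpt : ∀ c : ℝ, IsCompact (P ∩ {p | ∀ m, p m ≤ c})) {w p : EuclideanSpace ℝ (Fin M)}
    (hw : ∀ m, 0 < w m) (hp : p ∈ P) (hmin : ∀ q ∈ P, inner ℝ w p ≤ inner ℝ w q)
    (huniq : ∀ q ∈ P, (∀ r ∈ P, inner ℝ w q ≤ inner ℝ w r) → q = p) :
    HasGradientAt (fun w => sInf ((fun q => inner ℝ w q) '' P)) p w := by
  obtain ⟨δ, hδ, hδw⟩ := exists_pos_forall_le w hw
  -- Half the margin keeps the weights uniformly positive near `w`.
  have hpos : ∀ᶠ u in 𝓝 w, ∀ m, δ / 2 ≤ u m := by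
    refine eventually_all.2 fun m => ?_
    have hc : Tendsto (fun u : EuclideanSpace ℝ (Fin M) => u m) (𝓝 w) (𝓝 (w m)) :=
      (by fun_prop : Continuous fun u : EuclideanSpace ℝ (Fin M) => u m).tendsto w
    exact hc.eventually_const_le (by linarith [hδw m])
  -- The value `p` for the remaining `u` is a mere default.
  have hex : ∀ u : EuclideanSpace ℝ (Fin M), ∃ q, (∀ m, δ / 2 ≤ u m) →
      q ∈ P ∧ ∀ r ∈ P, inner ℝ u q ≤ inner ℝ u r := fun u => by
    by_cases hu : ∀ m, δ / 2 ≤ u m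
    · obtain ⟨q, hq, h⟩ := exists_isMinOn_inner ⟨p, hp⟩ hnn hcpt
        fun m => (half_pos hδ).trans_le (hu m)
      exact ⟨q, fun _ => ⟨hq, h⟩⟩
    · exact ⟨p, fun h => absurd h hu⟩
  choose s hs using hex
  have hbd : ∀ᶠ u in 𝓝 w, inner ℝ u p ≤ inner ℝ w p + 1 := by
    have hc : Tendsto (fun u => inner ℝ u p) (𝓝 w) (𝓝 (inner ℝ w p)) :=
      (by fun_prop : Continuous fun u : EuclideanSpace ℝ (Fin M) => inner ℝ u p).tendsto w
    exact hc.eventually_le_const (by linarith)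
  -- Minimizers for nearby weights stay in one compact truncation, and each of their cluster points
  -- minimizes at `w`, hence is `p`.
  have htend : Tendsto s (𝓝 w) (𝓝 p) := by
    refine (hcpt ((inner ℝ w p + 1) / (δ / 2))).tendsto_nhds_of_unique_mapClusterPt ?_ ?_
    · filter_upwards [hpos, hbd] with u hu hub
      obtain ⟨h1, h2⟩ := hs u hu
      exact ⟨h1, EuclideanSpace.apply_le_of_inner_le (half_pos hδ) hu (hnn _ h1)
        ((h2 p hp).trans hub)⟩
    · intro q hq hcl
      obtain ⟨U, hU, hUq⟩ := mapClusterPt_iff_ultrafilter.1 hcl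
      have hid : Tendsto (fun u => u) (U : Filter (EuclideanSpace ℝ (Fin M))) (𝓝 w) := hU
      refine huniq q hq.1 fun r hr => ?_
      refine le_of_tendsto_of_tendsto (hid.inner hUq) (hid.inner tendsto_const_nhds) ?_
      filter_upwards [hU hpos] with u hu
      exact (hs u hu).2 r hr
  rw [hasGradientAt_iff_isLittleO, Asymptotics.isLittleO_iff]
  intro c hc
  filter_upwards [hpos, Metric.tendsto_nhds.1 htend c hc] with u hu hdist
  obtain ⟨h1, h2⟩ := hs u hu
  rw [sInf_inner_eq h1 h2, sInf_inner_eq hp hmin, Real.norm_eq_abs, abs_le]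
  -- The error term is `⟪u, s u - p⟫`: at most zero because `s u` minimizes at `u`, at least `⟪u -
  -- w, s u - p⟫` because `p` minimizes at `w`.
  have h3 := h2 p hp
  have h4 := hmin _ h1
  have h5 : inner ℝ u (s u) - inner ℝ w p - inner ℝ p (u - w) =
      inner ℝ u (s u) - inner ℝ u p := by
    rw [inner_sub_right]
    linarith [real_inner_comm u p, real_inner_comm w p]
  have h6 : |inner ℝ (u - w) (s u - p)| ≤ c * ‖u - w‖ := by
    refine (abs_real_inner_le_norm _ _).trans ?_
    rw [mul_comm]
    exact mul_le_mul_of_nonneg_right (by rw [← dist_eq_norm]; exact hdist.le) (norm_nonneg _)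
  have h7 : inner ℝ (u - w) (s u - p) =
      inner ℝ u (s u) - inner ℝ u p - (inner ℝ w (s u) - inner ℝ w p) := by
    rw [inner_sub_left, inner_sub_right, inner_sub_right]
  rw [h5]
  constructor
  · linarith [(abs_le.1 h6).1]
  · linarith [mul_nonneg hc.le (norm_nonneg (u - w))]

end SupportFunction

/-! ### Entry bounds, principal blocks and closedness -/

namespace Matrix

variable {n : Type*} [Fintype n]

/-- For `A = Cᴴ C` this is the arithmetic-geometric mean inequality term by term. It lets bounded
antenna powers bound all matrix entries. -/
lemma PosSemidef.norm_apply_le {A : Matrix n n ℂ} (hA : A.PosSemidef) (i j : n) :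
    ‖A i j‖ ≤ ((A i i).re + (A j j).re) / 2 := by
  obtain ⟨C, rfl⟩ := hA.exists_eq_conjTranspose_mul_self
  have hd : ∀ i, ((Cᴴ * C) i i).re = ∑ l, ‖C l i‖ ^ 2 := fun i => by
    simp only [mul_apply, conjTranspose_apply, Complex.star_def, Complex.conj_mul', Complex.re_sum]
    norm_cast
  rw [hd, hd, ← Finset.sum_add_distrib, Finset.sum_div, mul_apply]
  refine (norm_sum_le _ _).trans (Finset.sum_le_sum fun l _ => ?_)
  rw [norm_mul, conjTranspose_apply, norm_star]
  nlinarith [sq_nonneg (‖C l i‖ - ‖C l j‖)]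

lemma hermForm_submatrix_val {p : n → Prop} [DecidablePred p] {A : Matrix n n ℂ}
    (hA : ∀ i j, ¬(p i ∧ p j) → A i j = 0) (x : n → ℂ) :
    hermForm (A.submatrix (Subtype.val : {i // p i} → n) Subtype.val) (fun i : {i // p i} => x i) =
      hermForm A x := by
  have hsum : ∀ f : n → ℂ, (∀ i, ¬p i → f i = 0) → ∑ i : {i // p i}, f i = ∑ i, f i :=
    fun f hf => by
      rw [← Fintype.sum_subtype_add_sum_subtype p f,
        Finset.sum_eq_zero (s := (Finset.univ : Finset {i // ¬p i})) fun i _ => hf i i.2, add_zero]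
  have hmul : ∀ i, ((A.submatrix (Subtype.val : {i // p i} → n) Subtype.val) *ᵥ
      fun j : {i // p i} => x j) i = (A *ᵥ x) i := fun i =>
    hsum (fun j => A i j * x j) fun j hj => by rw [hA _ _ fun h => hj h.2, zero_mul]
  simp only [hermForm, dotProduct, hmul, Pi.star_apply]
  rw [hsum fun i => star (x i) * (A *ᵥ x) i]
  intro i hi
  rw [mulVec, dotProduct, Finset.sum_eq_zero, mul_zero]
  exact fun j _ => by rw [hA _ _ fun h => hi h.1, zero_mul]

lemma isClosed_setOf_posSemidef : IsClosed {A : Matrix n n ℂ | A.PosSemidef} := by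
  simp only [posSemidef_iff_dotProduct_mulVec, Set.ofPred_and, Set.ofPred_forall]
  refine IsClosed.inter ?_ (isClosed_iInter fun x => ?_)
  · exact isClosed_eq (by fun_prop) continuous_id
  · exact isClosed_le continuous_const (by fun_prop)

end Matrix

/-! ### The power region, existence and the gradient -/

namespace Network

open Matrix

variable {M K : ℕ} {N : Network M K} {V : Fin K → Matrix (Fin M) (Fin M) ℂ}
  {Q : Matrix (Fin M) (Fin M) ℂ} {μ : EuclideanSpace ℝ (Fin M)}

/-- The vector of antenna powers. -/
def powerVector (x : (Fin K → Matrix (Fin M) (Fin M) ℂ) × Matrix (Fin M) (Fin M) ℂ) :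
    EuclideanSpace ℝ (Fin M) :=
  WithLp.toLp 2 (antennaPower x.1 x.2)

lemma continuous_antennaPower (m : Fin M) : Continuous
    fun x : (Fin K → Matrix (Fin M) (Fin M) ℂ) × Matrix (Fin M) (Fin M) ℂ =>
      antennaPower x.1 x.2 m := by
  unfold antennaPower
  fun_prop

lemma continuous_powerVector : Continuous (powerVector (M := M) (K := K)) :=
  (PiLp.continuous_toLp 2 _).comp (continuous_pi continuous_antennaPower)

lemma continuous_gain (N : Network M K) (k : Fin K) :
    Continuous fun A : Matrix (Fin M) (Fin M) ℂ => N.gain A k := by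
  unfold gain
  fun_prop

lemma continuous_fronthaulMatrix (N : Network M K) (m : Fin M) : Continuous
    fun x : (Fin K → Matrix (Fin M) (Fin M) ℂ) × Matrix (Fin M) (Fin M) ℂ =>
      N.fronthaulMatrix x.1 x.2 m := by
  refine continuous_matrix fun i j => ?_
  have hp : Continuous fun x : (Fin K → Matrix (Fin M) (Fin M) ℂ) × Matrix (Fin M) (Fin M) ℂ =>
      (antennaPower x.1 x.2 m : ℂ) := Complex.continuous_ofReal.comp (continuous_antennaPower m)
  have hQ : Continuous fun x : (Fin K → Matrix (Fin M) (Fin M) ℂ) × Matrix (Fin M) (Fin M) ℂ =>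
      x.2 i j := by fun_prop
  simp only [fronthaulMatrix, trailingBlock, Matrix.sub_apply, Matrix.smul_apply, of_apply,
    single_apply, smul_eq_mul]
  refine Continuous.sub (Continuous.mul continuous_const ?_) ?_
  · by_cases h : m ≤ i ∧ m ≤ j
    · simpa only [if_pos h] using hQ
    · simpa only [if_neg h] using continuous_const
  · by_cases h : m = i ∧ m = j
    · simpa only [if_pos h] using hp
    · simpa only [if_neg h] using continuous_const

lemma isClosed_setOf_feasible (N : Network M K) :
    IsClosed {x : (Fin K → Matrix (Fin M) (Fin M) ℂ) × Matrix (Fin M) (Fin M) ℂ |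
      N.Feasible x.1 x.2} := by
  have : {x : (Fin K → Matrix (Fin M) (Fin M) ℂ) × Matrix (Fin M) (Fin M) ℂ |
      N.Feasible x.1 x.2} = {x | (∀ k, (x.1 k).PosSemidef) ∧ x.2.PosSemidef ∧
        (∀ k, 0 ≤ N.sinrSlack x.1 x.2 k) ∧ ∀ m, (N.fronthaulMatrix x.1 x.2 m).PosSemidef} :=
    Set.ext fun x => ⟨fun h => ⟨h.1, h.2, h.3, h.4⟩, fun h => ⟨h.1, h.2.1, h.2.2.1, h.2.2.2⟩⟩
  rw [this]
  simp only [Set.ofPred_and, Set.ofPred_forall]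
  refine IsClosed.inter (isClosed_iInter fun k => ?_) (IsClosed.inter ?_
    (IsClosed.inter (isClosed_iInter fun k => ?_) (isClosed_iInter fun m => ?_)))
  · exact isClosed_setOf_posSemidef.preimage (by fun_prop)
  · exact isClosed_setOf_posSemidef.preimage continuous_snd
  · refine isClosed_le continuous_const ?_
    have hV : ∀ j, Continuous
        fun x : (Fin K → Matrix (Fin M) (Fin M) ℂ) × Matrix (Fin M) (Fin M) ℂ =>
          N.gain (x.1 j) k := fun j => (N.continuous_gain k).comp (by fun_prop)
    exact ((((hV k).const_mul _).sub (continuous_finsetSum _ fun j _ => hV j)).sub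
      ((N.continuous_gain k).comp continuous_snd)).sub continuous_const
  · exact isClosed_setOf_posSemidef.preimage (N.continuous_fronthaulMatrix m)

lemma isCompact_setOf_feasible_le (N : Network M K) (c : ℝ) :
    IsCompact {x : (Fin K → Matrix (Fin M) (Fin M) ℂ) × Matrix (Fin M) (Fin M) ℂ |
      N.Feasible x.1 x.2 ∧ ∀ m, antennaPower x.1 x.2 m ≤ c} := by
  let B : Set (Matrix (Fin M) (Fin M) ℂ) :=
    Set.univ.pi fun _ => Set.univ.pi fun _ => Metric.closedBall 0 c
  have hB : IsCompact B :=
    isCompact_univ_pi fun _ => isCompact_univ_pi fun _ => isCompact_closedBall 0 c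
  refine ((isCompact_univ_pi fun _ : Fin K => hB).prod hB).of_isClosed_subset ?_ ?_
  · have hle : IsClosed {x : (Fin K → Matrix (Fin M) (Fin M) ℂ) × Matrix (Fin M) (Fin M) ℂ |
        ∀ m, antennaPower x.1 x.2 m ≤ c} := by
      simp only [Set.ofPred_forall]
      exact isClosed_iInter fun m => isClosed_le (continuous_antennaPower m) continuous_const
    exact (isClosed_setOf_feasible N).inter hle
  · rintro ⟨V, Q⟩ ⟨hF, hc⟩
    -- Each diagonal entry is one of the nonnegative summands of an antenna power, hence at most
    -- `c`.
    have hbd : ∀ A : Matrix (Fin M) (Fin M) ℂ, A.PosSemidef →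
        (∀ m, (A m m).re ≤ antennaPower V Q m) → A ∈ B := fun A hA h i _ j _ => by
      rw [mem_closedBall_zero_iff]
      exact (hA.norm_apply_le i j).trans (by linarith [h i, h j, hc i, hc j])
    have hV : ∀ m k, 0 ≤ (V k m m).re := fun m k => (hF.posSemidef_V k).re_diag_nonneg m
    refine ⟨fun k _ => hbd _ (hF.posSemidef_V k) fun m => ?_, hbd _ hF.posSemidef_Q fun m => ?_⟩
    · rw [antennaPower_eq]
      have := Finset.single_le_sum (f := fun k => (V k m m).re) (fun k _ => hV m k)
        (Finset.mem_univ k)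
      linarith [hF.posSemidef_Q.re_diag_nonneg m]
    · rw [antennaPower_eq]
      linarith [Finset.sum_nonneg fun k (_ : k ∈ Finset.univ) => hV m k]

/-- The antenna power vectors of the feasible points. -/
def powerRegion (N : Network M K) : Set (EuclideanSpace ℝ (Fin M)) :=
  powerVector '' {x : (Fin K → Matrix (Fin M) (Fin M) ℂ) × Matrix (Fin M) (Fin M) ℂ |
    N.Feasible x.1 x.2}

lemma nonneg_of_mem_powerRegion {p : EuclideanSpace ℝ (Fin M)} (hp : p ∈ N.powerRegion)
    (m : Fin M) : 0 ≤ p m := by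
  obtain ⟨x, hx, rfl⟩ := hp
  exact antennaPower_nonneg hx.posSemidef_V hx.posSemidef_Q m

lemma isCompact_powerRegion_inter (N : Network M K) (c : ℝ) :
    IsCompact (N.powerRegion ∩ {p | ∀ m, p m ≤ c}) := by
  convert (isCompact_setOf_feasible_le N c).image continuous_powerVector using 1
  ext p
  constructor
  · rintro ⟨⟨x, hx, rfl⟩, hp⟩
    exact ⟨x, ⟨hx, hp⟩, rfl⟩
  · rintro ⟨x, ⟨hx, hp⟩, rfl⟩
    exact ⟨⟨x, hx, rfl⟩, hp⟩

lemma weightedPower_eq_inner (μ : EuclideanSpace ℝ (Fin M))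
    (V : Fin K → Matrix (Fin M) (Fin M) ℂ) (Q : Matrix (Fin M) (Fin M) ℂ) :
    weightedPower μ V Q = inner ℝ (μ + WithLp.toLp 2 1) (powerVector (V, Q)) := by
  simp [weightedPower, powerVector, PiLp.inner_apply, mul_comm, add_comm]

lemma optimalValue_eq (N : Network M K) (μ : EuclideanSpace ℝ (Fin M)) :
    N.optimalValue μ = sInf ((fun q => inner ℝ (μ + WithLp.toLp 2 1) q) '' N.powerRegion) := by
  unfold optimalValue
  congr 1
  ext r
  constructor
  · rintro ⟨V, Q, h, rfl⟩
    exact ⟨_, ⟨(V, Q), h, rfl⟩, (weightedPower_eq_inner μ V Q).symm⟩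
  · rintro ⟨_, ⟨⟨V, Q⟩, h, rfl⟩, rfl⟩
    exact ⟨V, Q, h, (weightedPower_eq_inner μ V Q).symm⟩

lemma isSolution_iff : N.IsSolution μ V Q ↔ N.Feasible V Q ∧ ∀ q ∈ N.powerRegion,
    inner ℝ (μ + WithLp.toLp 2 1) (powerVector (V, Q)) ≤ inner ℝ (μ + WithLp.toLp 2 1) q := by
  refine and_congr_right fun _ => ⟨?_, fun h V' Q' hF => ?_⟩
  · rintro h _ ⟨⟨V', Q'⟩, hF, rfl⟩
    rw [← weightedPower_eq_inner, ← weightedPower_eq_inner]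
    exact h _ _ hF
  · rw [weightedPower_eq_inner, weightedPower_eq_inner]
    exact h _ ⟨(V', Q'), hF, rfl⟩

/-- The problem with positive weights has a solution if it has a feasible point. -/
lemma Feasible.exists_isSolution (h : N.Feasible V Q) (hμ : ∀ m, 0 < 1 + μ m) :
    ∃ V' Q', N.IsSolution μ V' Q' := by
  obtain ⟨_, ⟨⟨V', Q'⟩, hF, rfl⟩, hmin⟩ := exists_isMinOn_inner (P := N.powerRegion)
    (w := μ + WithLp.toLp 2 1) ⟨_, (V, Q), h, rfl⟩ (fun p => nonneg_of_mem_powerRegion)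
    N.isCompact_powerRegion_inter (fun m => by simpa [add_comm] using hμ m)
  exact ⟨V', Q', isSolution_iff.2 ⟨hF, hmin⟩⟩

/-- Danskin's theorem needs a unique minimizing power vector, which uniqueness of the solution
gives; the shift of `μ` by the all-ones vector does not affect the gradient. -/
lemma IsSolution.hasGradientAt_optimalValue (hσ : ∀ k, 0 < N.σ k) (hγ : ∀ k, 0 < N.γ k)
    (hμ : ∀ m, 0 < 1 + μ m) (h : N.IsSolution μ V Q) :
    HasGradientAt N.optimalValue (powerVector (V, Q)) μ := by
  have hmin := isSolution_iff.1 h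
  have key := hasGradientAt_sInf_inner (P := N.powerRegion) (w := μ + WithLp.toLp 2 1)
    (fun p => nonneg_of_mem_powerRegion) N.isCompact_powerRegion_inter
    (fun m => by simpa [add_comm] using hμ m) ⟨(V, Q), h.1, rfl⟩ hmin.2 (by
      rintro _ ⟨⟨V', Q'⟩, hF, rfl⟩ hq
      obtain ⟨rfl, rfl⟩ := h.unique hσ hγ hμ (isSolution_iff.2 ⟨hF, hq⟩)
      rfl)
  rw [hasGradientAt_iff_hasFDerivAt] at key ⊢
  rw [show N.optimalValue = fun μ => _ from funext N.optimalValue_eq]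
  exact (hasFDerivAt_comp_add_right _).2 key

lemma StrictlyFeasible.feasible (h : N.StrictlyFeasible V Q) : N.Feasible V Q := by
  refine ⟨fun k => (h.posDef_V k).posSemidef, h.posDef_Q.posSemidef, fun k => (h.sinr k).le,
    fun m => ?_⟩
  have hH := isHermitian_fronthaulMatrix (N := N) (V := V) h.posDef_Q.1 m
  refine hH.posSemidef_of_hermForm_nonneg fun x => ?_
  rw [← hermForm_submatrix_val (p := fun i => m ≤ i) fun i j hij => ?_]
  · exact (h.fronthaul m).posSemidef.hermForm_nonneg _
  · have hm : ¬(m = i ∧ m = j) := fun h => hij ⟨h.1.le, h.2.le⟩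
    simp [fronthaulMatrix, trailingBlock, hij, hm]

end Network

theorem theorem2 {M K : ℕ} (N : Network M K)
    (hσ : ∀ k, 0 < N.σ k) (hγ : ∀ k, 0 < N.γ k)
    (hstrict : ∃ V Q, N.StrictlyFeasible V Q)
    (μ : EuclideanSpace ℝ (Fin M)) (hμ : ∀ m, 0 ≤ μ m) :
    ∃ V Q, N.IsSolution μ V Q ∧
      (∀ V' Q', N.IsSolution μ V' Q' → V' = V ∧ Q' = Q) ∧
      HasGradientAt N.dualFunction
        (WithLp.toLp 2 fun m => Network.antennaPower V Q m - N.P m) μ := by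
  have hw : ∀ m, 0 < 1 + μ m := fun m => by linarith [hμ m]
  obtain ⟨V₀, Q₀, h₀⟩ := hstrict
  obtain ⟨V, Q, h⟩ := h₀.feasible.exists_isSolution hw
  refine ⟨V, Q, h, fun V' Q' h' => h.unique hσ hγ hw h', ?_⟩
  have h1 := (h.hasGradientAt_optimalValue hσ hγ hw).hasFDerivAt
  have h2 := (InnerProductSpace.toDual ℝ (EuclideanSpace ℝ (Fin M))
    (WithLp.toLp 2 N.P)).hasFDerivAt (x := μ)
  rw [hasGradientAt_iff_hasFDerivAt]
  have h3 := h1.sub h2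
  rw [← map_sub] at h3
  -- The subtracted term is linear in the weights, with constant gradient `P`.
  have hf : N.dualFunction = fun ν => N.optimalValue ν -
      InnerProductSpace.toDual ℝ (EuclideanSpace ℝ (Fin M)) (WithLp.toLp 2 N.P) ν := by
    ext ν
    simp [Network.dualFunction, PiLp.inner_apply]
  rw [hf]
  exact h3
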